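/- Let $G=(V,E)$ be a connected simple graph that is $d$-regular for some integer $d\ge 0$ (in particular locally finite), and suppose that $V$ is infinite, or finite with $|V|$ even. For $f,g:V\to\mathbb R$ and $x\in V$ put $$\Delta f(x)=\sum_{y\sim x}(f(y)-f(x)),\qquad \Gamma(f,g)=\tfrac12\bigl(\Delta(fg)-(\Delta f)g-f\,\Delta g\bigr),$$ $$\Gamma_2(f,g)=\tfrac12\bigl(\Delta\Gamma(f,g)-\Gamma(\Delta f,g)-\Gamma(f,\Delta g)\bigr).$$ The Bakry–Émery curvature of $G$ at a vertex $x$ is $$K_{BE}(G,x)=\sup\{K\in\mathbb R:\ \Gamma_2(f,f)(x)\ge K\,\Gamma(f,f)(x)\ \text{for all } f:V\to\mathbb R\},$$ and the Bakry–Émery curvature of $G$ is $K_{BE}(G)=\inf_{x\in V}K_{BE}(G,x)$ (supremum and infimum in the extended real line). If $K_{BE}(G)\ge 0$, then $G$ has a perfect matching, that is, a set of pairwise disjoint edges such that every vertex of $G$ is incident with one of them. -/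

import Mathlib

namespace SimpleGraph

noncomputable section

variable {V : Type*}

/-- The (standard) graph Laplacian `Δ f (x) = ∑_{y ∼ x} (f y - f x)`. -/
def bakryLaplacian (G : SimpleGraph V) [G.LocallyFinite] (f : V → ℝ) (x : V) : ℝ :=
  ∑ y ∈ G.neighborFinset x, (f y - f x)

/-- The gradient form (carré du champ)
`Γ(f, g) = ½ (Δ(f g) - (Δ f) g - f (Δ g))`, evaluated at a vertex. -/
def bakryGamma (G : SimpleGraph V) [G.LocallyFinite] (f g : V → ℝ) (x : V) : ℝ :=
  (1 / 2 : ℝ) * (G.bakryLaplacian (fun v => f v * g v) x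
    - G.bakryLaplacian f x * g x - f x * G.bakryLaplacian g x)

/-- The iterated gradient form
`Γ₂(f, g) = ½ (Δ Γ(f, g) - Γ(Δ f, g) - Γ(f, Δ g))`, evaluated at a vertex. -/
def bakryGammaTwo (G : SimpleGraph V) [G.LocallyFinite] (f g : V → ℝ) (x : V) : ℝ :=
  (1 / 2 : ℝ) * (G.bakryLaplacian (G.bakryGamma f g) x
    - G.bakryGamma (G.bakryLaplacian f) g x - G.bakryGamma f (G.bakryLaplacian g) x)

/-- The curvature-dimension inequality `CD(∞, K)` at the vertex `x`:
`Γ₂(f)(x) ≥ K Γ(f)(x)` for every function `f : V → ℝ`. -/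
def BakryCDInfty (G : SimpleGraph V) [G.LocallyFinite] (K : ℝ) (x : V) : Prop :=
  ∀ f : V → ℝ, K * G.bakryGamma f f x ≤ G.bakryGammaTwo f f x

/-- The Bakry–Émery curvature at a vertex, `sup {K : ℝ | CD(∞, K) holds at x}`. The supremum is
taken in the extended reals, so no convention about empty or unbounded sets is hidden in it. -/
def bakryEmeryCurvatureAt (G : SimpleGraph V) [G.LocallyFinite] (x : V) : EReal :=
  sSup ((fun K : ℝ => (K : EReal)) '' {K : ℝ | G.BakryCDInfty K x})

/-- The Bakry–Émery curvature of a graph: the infimum over all vertices of the curvature at the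
vertex. -/
def bakryEmeryCurvature (G : SimpleGraph V) [G.LocallyFinite] : EReal :=
  ⨅ x : V, G.bakryEmeryCurvatureAt x

end

end SimpleGraph

/-!
The theorem rests on a lower bound for edge cuts: if a connected `d`-regular graph satisfies
`Γ₂(f) ≥ 0` for all `f`, then every nonempty finite proper vertex set `C` is left by at least
`d - 1` edges (`SimpleGraph.le_cutSize_add_one`). For odd `#C` the number of these
edges is congruent to `d` modulo two, so it is at least `d` (`SimpleGraph.le_cutSize_of_odd`).

To prove the bound, suppose that a minimum cut has at most `d - 2` edges. Minimality shows that at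
every vertex at most half of the edges are cut. Take a vertex `x` meeting the largest number `p` of
cut edges, on either side of the cut, say in `A`. If `f x = 0`, then
`4 Γ₂(f)(x) = ∑_{y ∼ x} ∑_{z ∼ y} (f z - 2 f y)² - 2 d ∑_{y ∼ x} f(y)² + 2 (∑_{y ∼ x} f y)²`
(`SimpleGraph.four_mul_bakryGammaTwo`). The test functions are layered along the cut: they increase
from `-t` inside `A` over `0` and `1` on the two boundaries of the cut to `2` on the other side. For
such functions the double sum is controlled by the number of cut edges
(`SimpleGraph.cut_test_function_inequality`). At `t = 0` a small cut makes the right hand side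
nonpositive, unless `p` is large or the parameters belong to a finite list; its derivative in `t` is
negative at `t = 0`, because `x` has neighbours inside `A` that meet no cut edge, and this rules out
the value zero and the finitely many exceptions. For large `p` a second test function is combined
with the first one; it has the value `1` only at the neighbours of `x` across the cut. The
numerical part is `cut_arithmetic`.

The perfect matching is obtained from Tutte's theorem. Given a finite set `A`, choose a finite set
`B` of even cardinality which contains `A` and its neighbours, and make `B \ A` a clique. After the
removal of a Tutte violator `U`, at least `#U + 1` odd components lie inside `A`, each of them sends
at least `d` edges into `U`, but `U` receives at most `d * #U` edges. So some matching of the graph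
covers `A`, and Rado's selection lemma passes from finite sets `A` to all of `V`.
-/

/-! ### Arithmetic of small cuts -/

/-- The numerical incompatibility behind `SimpleGraph.cut_contradiction`. There `k` is the size of
the cut, `p` the largest number of cut edges at a vertex, `h` the size of the outer boundary, `w`
the number of neighbours of the centre in the inner boundary and `S` the number of cut edges meeting
a given set of `p` boundary vertices. The last three hypotheses come from two test functions in the
curvature condition, the very last one being a discriminant, which makes `hE0` strict. For `p ≥ 8`
the inequalities `hE0` and `hE1` contradict each other; for `p ≤ 7` the strict form of `hE0` leaves
finitely many values of `k` and `d`, which are excluded with the help of the discriminant. -/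
lemma cut_arithmetic {p k d h w S : ℤ} (hp : 1 ≤ p) (hkd : k + 2 ≤ d) (hpd : 2 * p ≤ d)
    (hph : p ≤ h) (hhk : h ≤ k) (hw : 0 ≤ w) (hwk : w ≤ k - p) (hw2 : p = 2 → w ≤ h - 1)
    (hS : S ≤ k - h + p) (hSp : S ≤ p * p)
    (hE0 : 0 ≤ 4 * S + p * (h - 1) + (k - p) - 2 * d * p + 2 * p ^ 2)
    (hE1 : 0 ≤ 4 * S + p * (p - 1) + 4 * (k - p) - 2 * d * p + 2 * p ^ 2)
    (hdisc : 4 * p ^ 2 * (d - p - w) ^ 2 ≤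
      (4 * S + p * (h - 1) + (k - p) - 2 * d * p + 2 * p ^ 2) *
      (w * (d - 2) + 3 * (d - p - w) * (k - p + 1) - d * (d - p - w) + 2 * (d - p - w) ^ 2)) :
    False := by
  have hq : 2 ≤ d - p - w := by omega
  have hE0' : 1 ≤ 4 * S + p * (h - 1) + (k - p) - 2 * d * p + 2 * p ^ 2 := by
    rcases hE0.eq_or_lt with h0 | h0
    · rw [← h0] at hdisc
      nlinarith [mul_pos (show 0 < p by omega) (show 0 < d - p - w by omega)]
    · exact h0
  by_cases hp8 : 8 ≤ p
  · clear hdisc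
    -- the combination of `hE0'` with weight `4` and `hE1` with weight `p - 4` eliminates `h`
    have h1 : 4 ≤ d * (8 * p - 12 - 2 * p ^ 2) + 3 * p ^ 3 - 5 * p ^ 2 - 4 * p + 24 := by
      have h2 : (p - 4) * S ≤ (p - 4) * (k - h + p) := by nlinarith
      nlinarith [mul_nonneg (show 0 ≤ p - 4 by omega) hE1,
        mul_nonneg (show 0 ≤ 8 * p - 12 by omega) (show 0 ≤ d - 2 - k by omega)]
    -- the coefficient of `d` is negative, so that `2 * p` may be put for `d`
    have h3 : d * (8 * p - 12 - 2 * p ^ 2) ≤ 2 * p * (8 * p - 12 - 2 * p ^ 2) := by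
      nlinarith [mul_nonneg (show 0 ≤ d - 2 * p by omega)
        (show 0 ≤ 2 * p ^ 2 + 12 - 8 * p by nlinarith)]
    nlinarith [mul_nonneg (show 0 ≤ p - 8 by omega) (show 0 ≤ p * p by positivity),
      mul_nonneg (show 0 ≤ p - 8 by omega) (show 0 ≤ p by omega)]
  · have hp7 : p ≤ 7 := by omega
    have hk : k ≤ 13 ∧ d ≤ k + 3 := by
      clear hdisc
      interval_cases p <;> omega
    obtain ⟨hk, hd⟩ := hk
    have hk0 : 1 ≤ k := by omega
    clear hE0
    -- finitely many parameters remain, and for each of them the inequalities are linear in `S`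
    obtain rfl | rfl : d = k + 2 ∨ d = k + 3 := by omega
    all_goals
      interval_cases p <;> interval_cases k <;> first
      | omega
      | (interval_cases h <;> first
        | omega
        | (interval_cases w <;> omega))

namespace SimpleGraph

open Finset

variable {V : Type*} {G : SimpleGraph V} [G.LocallyFinite] {A : Set V}

/-! ### The iterated gradient form on regular graphs -/

lemma bakryGamma_eq (G : SimpleGraph V) [G.LocallyFinite] (f g : V → ℝ) (x : V) :
    G.bakryGamma f g x = 1 / 2 * ∑ y ∈ G.neighborFinset x, (f y - f x) * (g y - g x) := by
  unfold bakryGamma bakryLaplacian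
  congr 1
  rw [Finset.sum_mul, Finset.mul_sum, ← Finset.sum_sub_distrib, ← Finset.sum_sub_distrib]
  exact Finset.sum_congr rfl fun y _ => by ring

/-- On a `d`-regular graph, after normalising `f x = 0`, the form `4 Γ₂(f)(x)` is a sum of squares
over the walks `x ∼ y ∼ z` (the walk back to `z = x` included), up to a quadratic form in the values
of `f` on the neighbours of `x`. -/
lemma four_mul_bakryGammaTwo {d : ℕ} (hreg : G.IsRegularOfDegree d) (f : V → ℝ) {x : V}
    (hx : f x = 0) :
    4 * G.bakryGammaTwo f f x
      = ∑ y ∈ G.neighborFinset x, ∑ z ∈ G.neighborFinset y, (f z - 2 * f y) ^ 2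
        - 2 * d * ∑ y ∈ G.neighborFinset x, f y ^ 2 + 2 * (∑ y ∈ G.neighborFinset x, f y) ^ 2 := by
  have hcard : ∀ y, ((G.neighborFinset y).card : ℝ) = d := fun y => by
    rw [card_neighborFinset_eq_degree, hreg y]
  have hL : G.bakryLaplacian f x = ∑ y ∈ G.neighborFinset x, f y := by
    simp [bakryLaplacian, hx]
  have hGG : G.bakryGamma f f x = 1 / 2 * ∑ y ∈ G.neighborFinset x, f y ^ 2 := by
    rw [bakryGamma_eq]
    simp [hx, pow_two]
  have hcomm : G.bakryGamma (G.bakryLaplacian f) f x = G.bakryGamma f (G.bakryLaplacian f) x := by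
    simp only [bakryGamma_eq, mul_comm]
  have hinner : ∀ y, ∑ z ∈ G.neighborFinset y, (f z - 2 * f y) ^ 2
      = 2 * G.bakryGamma f f y - 2 * f y * G.bakryLaplacian f y + d * f y ^ 2 := fun y => by
    rw [bakryGamma_eq, bakryLaplacian, Finset.mul_sum, Finset.mul_sum, Finset.mul_sum, ← hcard y,
      ← nsmul_eq_mul, ← Finset.sum_const, ← Finset.sum_sub_distrib, ← Finset.sum_add_distrib]
    exact Finset.sum_congr rfl fun z _ => by ring
  have h2 : G.bakryGamma f (G.bakryLaplacian f) x
      = 1 / 2 * (∑ y ∈ G.neighborFinset x, f y * G.bakryLaplacian f y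
        - (∑ y ∈ G.neighborFinset x, f y) * ∑ y ∈ G.neighborFinset x, f y) := by
    rw [bakryGamma_eq, Finset.sum_mul, ← Finset.sum_sub_distrib, hL]
    congr 1
    exact Finset.sum_congr rfl fun z _ => by rw [hx]; ring
  have h3 : G.bakryLaplacian (G.bakryGamma f f) x
      = ∑ y ∈ G.neighborFinset x, G.bakryGamma f f y
        - d * (1 / 2 * ∑ y ∈ G.neighborFinset x, f y ^ 2) := by
    rw [bakryLaplacian, Finset.sum_sub_distrib, Finset.sum_const, nsmul_eq_mul, hcard, hGG]
  simp only [hinner, Finset.sum_add_distrib, Finset.sum_sub_distrib, ← Finset.mul_sum, mul_assoc]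
  rw [bakryGammaTwo, hcomm, h2, h3]
  ring

lemma bakryGamma_self_nonneg (G : SimpleGraph V) [G.LocallyFinite] (f : V → ℝ) (x : V) :
    0 ≤ G.bakryGamma f f x := by
  rw [bakryGamma_eq]
  exact mul_nonneg (by norm_num) (Finset.sum_nonneg fun y _ => mul_self_nonneg _)

lemma bakryGammaTwo_nonneg (hcurv : 0 ≤ G.bakryEmeryCurvature) (f : V → ℝ) (x : V) :
    0 ≤ G.bakryGammaTwo f f x := by
  have hx : 0 ≤ G.bakryEmeryCurvatureAt x := hcurv.trans (iInf_le _ x)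
  by_contra! hneg
  -- a threshold `K < 0` with `K * Γ(f) > Γ₂(f)` bounds the admissible curvatures away from `0`
  obtain ⟨K, hK0, hK⟩ : ∃ K : ℝ, K < 0 ∧ G.bakryGammaTwo f f x < K * G.bakryGamma f f x := by
    have h0 := G.bakryGamma_self_nonneg f x
    refine ⟨G.bakryGammaTwo f f x / (G.bakryGamma f f x + 1), div_neg_of_neg_of_pos hneg
      (by positivity), ?_⟩
    rw [div_mul_eq_mul_div, lt_div_iff₀ (by positivity)]
    nlinarith
  have hle : G.bakryEmeryCurvatureAt x ≤ (K : EReal) := by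
    refine sSup_le ?_
    rintro _ ⟨L, hL, rfl⟩
    rw [EReal.coe_le_coe_iff]
    by_contra! hlt
    have := hL f
    have := mul_le_mul_of_nonneg_right hlt.le (G.bakryGamma_self_nonneg f x)
    linarith
  have := hx.trans hle
  rw [← EReal.coe_zero, EReal.coe_le_coe_iff] at this
  linarith

/-! ### Edge boundaries and layered test functions -/

open scoped Classical in
/-- The number of neighbours of `v` on the other side of the cut `(A, Aᶜ)`. -/
noncomputable def crossDegree (G : SimpleGraph V) [G.LocallyFinite] (A : Set V)
    (v : V) : ℕ :=
  #{u ∈ G.neighborFinset v | ¬(u ∈ A ↔ v ∈ A)}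

lemma crossDegree_compl (G : SimpleGraph V) [G.LocallyFinite] (A : Set V) (v : V) :
    G.crossDegree Aᶜ v = G.crossDegree A v := by
  unfold crossDegree
  congr! 2
  simp only [Set.mem_compl_iff]
  tauto

lemma crossDegree_pos {u v : V} (huv : G.Adj v u) (h : ¬(u ∈ A ↔ v ∈ A)) :
    0 < G.crossDegree A v :=
  Finset.card_pos.2 ⟨u, by simp [huv, h]⟩

lemma exists_adj_of_crossDegree_pos {v : V} (h : 0 < G.crossDegree A v) :
    ∃ u, G.Adj v u ∧ ¬(u ∈ A ↔ v ∈ A) := by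
  obtain ⟨u, hu⟩ := Finset.card_pos.1 h
  simp only [mem_filter, mem_neighborFinset] at hu
  exact ⟨u, hu⟩

/-- The two finite sets `I` and `J` are the inner and the outer vertex boundary of `A`. -/
structure IsCutBoundary (G : SimpleGraph V) [G.LocallyFinite] (A : Set V) (I J : Finset V) :
    Prop where
  mem_inner : ∀ v, v ∈ I ↔ v ∈ A ∧ 0 < G.crossDegree A v
  mem_outer : ∀ v, v ∈ J ↔ v ∉ A ∧ 0 < G.crossDegree A v

lemma IsCutBoundary.compl {I J : Finset V} (h : G.IsCutBoundary A I J) :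
    G.IsCutBoundary Aᶜ J I where
  mem_inner v := by rw [crossDegree_compl, h.mem_outer]; rfl
  mem_outer v := by rw [crossDegree_compl, h.mem_inner, Set.mem_compl_iff, not_not]

open scoped Classical in
/-- Both sums count the edges of the cut. -/
lemma IsCutBoundary.sum_crossDegree_eq {I J : Finset V} (h : G.IsCutBoundary A I J) :
    ∑ v ∈ I, G.crossDegree A v = ∑ v ∈ J, G.crossDegree A v := by
  have key := Finset.sum_card_bipartiteAbove_eq_sum_card_bipartiteBelow (s := I) (t := J) G.Adj
  convert key using 1
  · refine Finset.sum_congr rfl fun v hv => ?_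
    unfold crossDegree bipartiteAbove
    congr 1
    ext u
    have hvA := ((h.mem_inner v).1 hv).1
    simp only [mem_filter, mem_neighborFinset, hvA, iff_true]
    exact ⟨fun ⟨h1, h2⟩ => ⟨(h.mem_outer u).2 ⟨h2, crossDegree_pos h1.symm (by tauto)⟩, h1⟩,
      fun ⟨h1, h2⟩ => ⟨h2, ((h.mem_outer u).1 h1).1⟩⟩
  · refine Finset.sum_congr rfl fun v hv => ?_
    unfold crossDegree bipartiteBelow
    congr 1
    ext u
    have hvA := ((h.mem_outer v).1 hv).1
    simp only [mem_filter, mem_neighborFinset, hvA, iff_false, not_not]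
    exact ⟨fun ⟨h1, h2⟩ => ⟨(h.mem_inner u).2 ⟨h2, crossDegree_pos h1.symm (by tauto)⟩, h1.symm⟩,
      fun ⟨h1, h2⟩ => ⟨h2.symm, ((h.mem_inner u).1 h1).1⟩⟩

open scoped Classical in
/-- The curvature condition at a vertex `x` of the inner boundary, tested on the function which
takes the value `-t` inside `A`, `0` on the inner boundary `I`, `1` on the part `J'` of the outer
boundary, and `2` on the rest of the complement of `A`. The neighbours of `x` are split into those
outside `A` (`P`), in `I` (`W`) and inside `A` (`Q`). The factor `b` bounds the squared values of
the test function next to `I`: it is `1` if `J' = J` and `4` in general. -/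
lemma cut_test_function_inequality {d : ℕ} (hreg : G.IsRegularOfDegree d)
    (hΓ : ∀ (f : V → ℝ) x, 0 ≤ G.bakryGammaTwo f f x) {I J : Finset V}
    (hIJ : G.IsCutBoundary A I J) {x : V} (hx : x ∈ I) {J' : Finset V} (hJ' : J' ⊆ J)
    {P W Q : Finset V} (hP : P = {v ∈ G.neighborFinset x | v ∉ A})
    (hW : W = {v ∈ G.neighborFinset x | v ∈ I})
    (hQ : Q = {v ∈ G.neighborFinset x | v ∈ A ∧ v ∉ I}) (hPJ' : P ⊆ J') {b : ℝ} (hb : 1 ≤ b)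
    (hJb : ∀ u ∈ J, u ∉ J' → 4 ≤ b) (t : ℝ) :
    0 ≤ 4 * ∑ y ∈ P, (G.crossDegree A y : ℝ) + #P * (#J' - 1) + b * ∑ w ∈ W, (G.crossDegree A w : ℝ)
      + t ^ 2 * (#W * (d - 2) + #Q * (d + 3 * #I)) - 2 * d * (#P + #Q * t ^ 2)
      + 2 * (#P - #Q * t) ^ 2 := by
  have hxA : x ∈ A := ((hIJ.mem_inner x).1 hx).1
  have hsplit : ∀ g : V → ℝ, ∑ y ∈ G.neighborFinset x, g y
      = ∑ y ∈ P, g y + ∑ y ∈ W, g y + ∑ y ∈ Q, g y := by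
    intro g
    rw [hP, hW, hQ, Finset.sum_filter, Finset.sum_filter, Finset.sum_filter,
      ← Finset.sum_add_distrib, ← Finset.sum_add_distrib]
    refine Finset.sum_congr rfl fun y _ => ?_
    have : y ∈ I → y ∈ A := fun hy => ((hIJ.mem_inner y).1 hy).1
    by_cases h1 : y ∈ A <;> by_cases h2 : y ∈ I <;> simp_all
  have hcardN : ∀ y, (#(G.neighborFinset y) : ℝ) = d := fun y => by
    rw [card_neighborFinset_eq_degree, hreg y]
  set f : V → ℝ := fun v => if v ∈ A then (if v ∈ I then 0 else -t) else (if v ∈ J' then 1 else 2)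
    with hf
  have hfI : ∀ v ∈ I, f v = 0 := fun v hv => by simp [hf, ((hIJ.mem_inner v).1 hv).1, hv]
  have hfA : ∀ v ∈ A, v ∉ I → f v = -t := fun v hv hv' => by simp [hf, hv, hv']
  have hfJ' : ∀ v ∈ J', f v = 1 := fun v hv => by
    simp [hf, ((hIJ.mem_outer v).1 (hJ' hv)).1, hv]
  have hfB : ∀ v ∉ A, v ∉ J' → f v = 2 := fun v hv hv' => by simp [hf, hv, hv']
  have hfP : ∀ v ∈ P, f v = 1 := fun v hv => hfJ' v (hPJ' hv)
  have hfW : ∀ v ∈ W, f v = 0 := fun v hv => hfI v (by rw [hW] at hv; simp_all)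
  have hfQ : ∀ v ∈ Q, f v = -t := fun v hv => by
    rw [hQ, mem_filter] at hv; exact hfA v hv.2.1 hv.2.2
  have hmain := four_mul_bakryGammaTwo hreg f (hfI x hx)
  have hsum1 : ∑ y ∈ G.neighborFinset x, f y = #P - #Q * t := by
    rw [hsplit, Finset.sum_congr rfl hfP, Finset.sum_congr rfl hfW, Finset.sum_congr rfl hfQ]
    simp; ring
  have hsum2 : ∑ y ∈ G.neighborFinset x, f y ^ 2 = #P + #Q * t ^ 2 := by
    have h1 : ∑ y ∈ P, f y ^ 2 = ∑ y ∈ P, 1 ^ 2 :=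
      Finset.sum_congr rfl fun y hy => by rw [hfP y hy]
    have h2 : ∑ y ∈ W, f y ^ 2 = ∑ y ∈ W, 0 ^ 2 :=
      Finset.sum_congr rfl fun y hy => by rw [hfW y hy]
    have h3 : ∑ y ∈ Q, f y ^ 2 = ∑ y ∈ Q, (-t) ^ 2 :=
      Finset.sum_congr rfl fun y hy => by rw [hfQ y hy]
    rw [hsplit (fun y => f y ^ 2), h1, h2, h3]
    simp
  have hinP : ∀ y ∈ P, ∑ z ∈ G.neighborFinset y, (f z - 2 * f y) ^ 2
      ≤ 4 * (G.crossDegree A y : ℝ) + (#J' - 1) := by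
    intro y hy
    have hyA : y ∉ A := by rw [hP] at hy; simp_all
    have hcount : #{z ∈ G.neighborFinset y | z ∈ J'} ≤ #J' - 1 := by
      rw [← Finset.card_erase_of_mem (hPJ' hy)]
      refine Finset.card_le_card fun z hz => ?_
      simp only [mem_filter, mem_neighborFinset] at hz
      exact Finset.mem_erase.2 ⟨hz.1.ne', hz.2⟩
    have hJpos : 1 ≤ #J' := Finset.card_pos.2 ⟨y, hPJ' hy⟩
    have hcount' : (#{z ∈ G.neighborFinset y | z ∈ J'} : ℝ) ≤ #J' - 1 := by
      rw [← Nat.cast_one, ← Nat.cast_sub hJpos]; exact_mod_cast hcount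
    calc ∑ z ∈ G.neighborFinset y, (f z - 2 * f y) ^ 2
        ≤ ∑ z ∈ G.neighborFinset y,
          (4 * (if ¬(z ∈ A ↔ y ∈ A) then 1 else 0) + (if z ∈ J' then 1 else 0) : ℝ) := by
          refine Finset.sum_le_sum fun z hz => ?_
          rw [mem_neighborFinset] at hz
          rw [hfP y hy]
          by_cases hzA : z ∈ A
          · have hzI : z ∈ I := (hIJ.mem_inner z).2 ⟨hzA, crossDegree_pos hz.symm (by tauto)⟩
            rw [hfI z hzI, if_pos (by tauto)]
            split_ifs <;> norm_num
          · by_cases hzJ : z ∈ J'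
            · simp only [hfJ' z hzJ, hzA, hyA, hzJ]; norm_num
            · simp only [hfB z hzA hzJ, hzA, hyA, hzJ]; norm_num
      _ = 4 * (G.crossDegree A y : ℝ) + #{z ∈ G.neighborFinset y | z ∈ J'} := by
          rw [Finset.sum_add_distrib, ← Finset.mul_sum, Finset.sum_boole, Finset.sum_boole]
          rfl
      _ ≤ _ := by linarith
  have hinW : ∀ y ∈ W, ∑ z ∈ G.neighborFinset y, (f z - 2 * f y) ^ 2
      ≤ b * (G.crossDegree A y : ℝ) + t ^ 2 * (d - 2) := by
    intro y hy
    have hyI : y ∈ I := by rw [hW] at hy; simp_all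
    have hyx : G.Adj y x := by
      rw [hW, mem_filter, mem_neighborFinset] at hy; exact hy.1.symm
    obtain ⟨hyA, hypos⟩ := (hIJ.mem_inner y).1 hyI
    have hcount : (#{z ∈ G.neighborFinset y | z ∈ A ∧ z ∉ I} : ℝ) ≤ d - 2 := by
      obtain ⟨u, hu, huA⟩ := exists_adj_of_crossDegree_pos hypos
      have hux : x ≠ u := by rintro rfl; tauto
      have hsub : {z ∈ G.neighborFinset y | z ∈ A ∧ z ∉ I} ∪ {x, u} ⊆ G.neighborFinset y := by
        intro z hz
        simp only [mem_union, mem_filter, mem_insert, mem_singleton] at hz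
        rcases hz with hz | rfl | rfl
        · exact hz.1
        · simpa using hyx
        · simpa using hu
      have hdisj : Disjoint {z ∈ G.neighborFinset y | z ∈ A ∧ z ∉ I} {x, u} := by
        rw [Finset.disjoint_left]
        intro z hz hz'
        simp only [mem_filter, mem_insert, mem_singleton] at hz hz'
        rcases hz' with rfl | rfl <;> tauto
      have := Finset.card_le_card hsub
      rw [Finset.card_union_of_disjoint hdisj, Finset.card_pair hux,
        card_neighborFinset_eq_degree, hreg y] at this
      have : (#{z ∈ G.neighborFinset y | z ∈ A ∧ z ∉ I} : ℝ) + 2 ≤ d := by exact_mod_cast this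
      linarith
    calc ∑ z ∈ G.neighborFinset y, (f z - 2 * f y) ^ 2
        ≤ ∑ z ∈ G.neighborFinset y,
          (b * (if ¬(z ∈ A ↔ y ∈ A) then 1 else 0) + t ^ 2 * (if z ∈ A ∧ z ∉ I then 1 else 0)) := by
          refine Finset.sum_le_sum fun z hz => ?_
          rw [mem_neighborFinset] at hz
          rw [hfW y hy]
          by_cases hzA : z ∈ A
          · by_cases hzI : z ∈ I
            · simp [hfI z hzI, hzA, hyA, hzI]
            · simp [hfA z hzA hzI, hzA, hyA, hzI]
          · have hzJ : z ∈ J := (hIJ.mem_outer z).2 ⟨hzA, crossDegree_pos hz.symm (by tauto)⟩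
            by_cases hzJ' : z ∈ J'
            · simpa [hfJ' z hzJ', hzA, hyA] using hb
            · have := hJb z hzJ hzJ'
              simp only [hfB z hzA hzJ', hzA, hyA]; norm_num; linarith
      _ = b * (G.crossDegree A y : ℝ) + t ^ 2 * #{z ∈ G.neighborFinset y | z ∈ A ∧ z ∉ I} := by
          rw [Finset.sum_add_distrib, ← Finset.mul_sum, ← Finset.mul_sum, Finset.sum_boole,
            Finset.sum_boole]
          rfl
      _ ≤ _ := by gcongr
  have hinQ : ∀ y ∈ Q, ∑ z ∈ G.neighborFinset y, (f z - 2 * f y) ^ 2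
      ≤ t ^ 2 * (d + 3 * #I) := by
    intro y hy
    have hyQ := hy
    rw [hQ, mem_filter] at hyQ
    obtain ⟨-, hyA, hyI⟩ := hyQ
    calc ∑ z ∈ G.neighborFinset y, (f z - 2 * f y) ^ 2
        = ∑ z ∈ G.neighborFinset y, (t ^ 2 * (1 + 3 * (if z ∈ I then 1 else 0))) := by
          refine Finset.sum_congr rfl fun z hz => ?_
          rw [mem_neighborFinset] at hz
          have hzA : z ∈ A := by
            by_contra hzA
            exact hyI ((hIJ.mem_inner y).2 ⟨hyA, crossDegree_pos hz (by tauto)⟩)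
          rw [hfQ y hy]
          by_cases hzI : z ∈ I
          · rw [hfI z hzI, if_pos hzI]; ring
          · rw [hfA z hzA hzI, if_neg hzI]; ring
      _ = t ^ 2 * (d + 3 * #{z ∈ G.neighborFinset y | z ∈ I}) := by
          rw [← Finset.mul_sum, Finset.sum_add_distrib, ← Finset.mul_sum, Finset.sum_boole,
            Finset.sum_const, nsmul_one, hcardN]
      _ ≤ _ := by
          gcongr
          intro z hz
          exact (Finset.mem_filter.1 hz).2
  have hΓx := hΓ f x
  have h1 := Finset.sum_le_sum hinP
  have h2 := Finset.sum_le_sum hinW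
  have h3 := Finset.sum_le_sum hinQ
  rw [Finset.sum_add_distrib, ← Finset.mul_sum, Finset.sum_const, nsmul_eq_mul] at h1 h2
  rw [Finset.sum_const, nsmul_eq_mul] at h3
  rw [hsplit (fun y => ∑ z ∈ G.neighborFinset y, (f z - 2 * f y) ^ 2), hsum1, hsum2] at hmain
  linarith

open scoped Classical in
/-- Under nonnegative curvature there is no cut with at most `d - 2` edges all of whose crossing
degrees are at most `d / 2`, provided that the crossing degree at some `x ∈ I` dominates those on
the other side, and that `I` is not larger than `J` if that degree is two. -/
lemma cut_contradiction {d : ℕ} (hreg : G.IsRegularOfDegree d)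
    (hΓ : ∀ (f : V → ℝ) x, 0 ≤ G.bakryGammaTwo f f x) {I J : Finset V}
    (hIJ : G.IsCutBoundary A I J) {x : V} (hx : x ∈ I)
    (hmax : ∀ v, v ∈ J → G.crossDegree A v ≤ G.crossDegree A x)
    (hsmall : ∑ v ∈ I, G.crossDegree A v + 2 ≤ d) (hhalf : 2 * G.crossDegree A x ≤ d)
    (hside : G.crossDegree A x = 2 → #I ≤ #J) : False := by
  obtain ⟨hxA, hxpos⟩ := (hIJ.mem_inner x).1 hx
  obtain ⟨P, hP⟩ : ∃ P, P = {v ∈ G.neighborFinset x | v ∉ A} := ⟨_, rfl⟩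
  obtain ⟨W, hW⟩ : ∃ W, W = {v ∈ G.neighborFinset x | v ∈ I} := ⟨_, rfl⟩
  obtain ⟨Q, hQ⟩ : ∃ Q, Q = {v ∈ G.neighborFinset x | v ∈ A ∧ v ∉ I} := ⟨_, rfl⟩
  have hpcard : G.crossDegree A x = #P := by
    rw [hP]; unfold crossDegree; simp [hxA]
  have hPJ : P ⊆ J := fun y hy => by
    rw [hP, mem_filter, mem_neighborFinset] at hy
    exact (hIJ.mem_outer y).2 ⟨hy.2, crossDegree_pos hy.1.symm (by tauto)⟩
  have hWI : W ⊆ I.erase x := fun y hy => by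
    rw [hW, mem_filter, mem_neighborFinset] at hy
    exact mem_erase.2 ⟨hy.1.ne', hy.2⟩
  have hcards : #P + #W + #Q = d := by
    have hPW : Disjoint P W := by
      rw [Finset.disjoint_left]; intro y hy hy'
      rw [hP, mem_filter] at hy
      rw [hW, mem_filter] at hy'
      exact hy.2 ((hIJ.mem_inner y).1 hy'.2).1
    have hPWQ : Disjoint (P ∪ W) Q := by
      rw [Finset.disjoint_left]; intro y hy hy'
      simp only [hP, hW, hQ, mem_union, mem_filter] at hy hy'
      tauto
    rw [← Finset.card_union_of_disjoint hPW, ← Finset.card_union_of_disjoint hPWQ, ← hreg x,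
      ← card_neighborFinset_eq_degree]
    congr 1
    ext y
    have : y ∈ I → y ∈ A := fun hy => ((hIJ.mem_inner y).1 hy).1
    simp only [hP, hW, hQ, mem_union, mem_filter]
    tauto
  set k := ∑ v ∈ I, G.crossDegree A v with hk
  have hkJ : k = ∑ v ∈ J, G.crossDegree A v := hIJ.sum_crossDegree_eq
  set S := ∑ y ∈ P, G.crossDegree A y with hS
  have hposI : ∀ v ∈ I, 1 ≤ G.crossDegree A v := fun v hv => ((hIJ.mem_inner v).1 hv).2
  have hposJ : ∀ v ∈ J, 1 ≤ G.crossDegree A v := fun v hv => ((hIJ.mem_outer v).1 hv).2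
  have hJk : #J ≤ k := by
    rw [hkJ, Finset.card_eq_sum_ones]; exact Finset.sum_le_sum hposJ
  have hPle : #P ≤ #J := Finset.card_le_card hPJ
  have hSk : S + #J ≤ k + #P := by
    have h1 : #(J \ P) ≤ ∑ y ∈ J \ P, G.crossDegree A y := by
      rw [Finset.card_eq_sum_ones]
      exact Finset.sum_le_sum fun v hv => hposJ v (Finset.mem_sdiff.1 hv).1
    have h2 := Finset.sum_sdiff (f := G.crossDegree A) hPJ
    have h3 := Finset.card_sdiff_add_card_eq_card hPJ
    omega
  have hSp : S ≤ #P * #P := by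
    rw [← smul_eq_mul]
    exact Finset.sum_le_card_nsmul _ _ _ fun y hy => hpcard ▸ hmax y (hPJ hy)
  have herase : ∑ v ∈ I.erase x, G.crossDegree A v + #P = k := by
    rw [← hpcard]; exact Finset.sum_erase_add I _ hx
  have hWsum : ∑ w ∈ W, G.crossDegree A w + #P ≤ k := by
    have := Finset.sum_le_sum_of_subset (f := G.crossDegree A) hWI
    omega
  have hIcard : #I + #P ≤ k + 1 := by
    have h1 : #(I.erase x) ≤ ∑ v ∈ I.erase x, G.crossDegree A v := by
      rw [Finset.card_eq_sum_ones]
      exact Finset.sum_le_sum fun v hv => hposI v (Finset.mem_of_mem_erase hv)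
    have := Finset.card_erase_add_one hx
    omega
  have hWcard : #W + 1 ≤ #I := by
    have := Finset.card_erase_add_one hx
    have := Finset.card_le_card hWI
    omega
  have hq : (#Q : ℝ) = d - #P - #W := by
    have : (#P + #W + #Q : ℝ) = d := by exact_mod_cast hcards
    linarith
  have hSR : ∑ y ∈ P, (G.crossDegree A y : ℝ) = S := by rw [hS]; push_cast; rfl
  have hWR : ∑ y ∈ W, (G.crossDegree A y : ℝ) ≤ k - #P := by
    have : (∑ w ∈ W, (G.crossDegree A w : ℝ)) + #P ≤ k := by exact_mod_cast hWsum
    linarith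
  have hIR : (#I : ℝ) ≤ k - #P + 1 := by
    have : (#I : ℝ) + #P ≤ k + 1 := by exact_mod_cast hIcard
    linarith
  -- `J' = J` and arbitrary `t`: a quadratic polynomial in `t` without negative values
  have hquad : ∀ t : ℝ, 0 ≤ (#W * (d - 2) + 3 * #Q * (k - #P + 1) - d * #Q + 2 * #Q ^ 2) * (t * t)
      + (-4 * #P * #Q) * t + (4 * S + #P * (#J - 1) + (k - #P) - 2 * d * #P + 2 * #P ^ 2) := by
    intro t
    have := cut_test_function_inequality hreg hΓ hIJ hx subset_rfl hP hW hQ hPJ le_rfl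
      (fun u hu hu' => absurd hu hu') t
    rw [hSR] at this
    have h2 : t ^ 2 * (#W * (d - 2) + #Q * (d + 3 * #I) : ℝ)
        ≤ t ^ 2 * (#W * (d - 2) + #Q * (d + 3 * (k - #P + 1))) := by gcongr
    linarith
  have hE0 := hquad 0
  have hdisc := discrim_le_zero hquad
  -- `J' = P` and `t = 0`: this is the stronger test if `x` has many neighbours outside `A`
  have hE1 := cut_test_function_inequality hreg hΓ hIJ hx hPJ hP hW hQ subset_rfl
    (show (1 : ℝ) ≤ 4 by norm_num) (fun u hu hu' => le_rfl) 0
  rw [hSR] at hE1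
  have hE1' : (0 : ℝ) ≤ 4 * S + #P * (#P - 1) + 4 * (k - #P) - 2 * d * #P + 2 * #P ^ 2 := by
    linarith
  rw [discrim, hq] at hdisc
  refine cut_arithmetic (p := #P) (k := k) (d := d) (h := #J) (w := #W) (S := S) (by omega)
    (by omega) (by omega) (by omega) (by omega) (by omega) (by omega) (fun h => ?_) (by omega)
    (by exact_mod_cast hSp) ?_ ?_ ?_
  · have := hside (by omega)
    omega
  · have : (0 : ℝ) ≤ 4 * S + #P * (#J - 1) + (k - #P) - 2 * d * #P + 2 * #P ^ 2 := by linarith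
    exact_mod_cast this
  · exact_mod_cast hE1'
  · have : (4 * #P ^ 2 * (d - #P - #W) ^ 2 : ℝ) ≤
      (4 * S + #P * (#J - 1) + (k - #P) - 2 * d * #P + 2 * #P ^ 2) *
      (#W * (d - 2) + 3 * (d - #P - #W) * (k - #P + 1) - d * (d - #P - #W)
        + 2 * (d - #P - #W) ^ 2) := by linarith
    exact_mod_cast this

/-! ### Lower bounds for edge cuts -/

/-- A centre for `cut_contradiction` exists on one of the two sides of the cut: it is a vertex of
maximal crossing degree, on the side of the smaller boundary if both sides attain the maximum. -/
lemma cut_contradiction_of_card_le {d : ℕ} (hreg : G.IsRegularOfDegree d)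
    (hΓ : ∀ (f : V → ℝ) x, 0 ≤ G.bakryGammaTwo f f x) {I J : Finset V}
    (hIJ : G.IsCutBoundary A I J) (hI : I.Nonempty) (hJ : J.Nonempty) (hcard : #I ≤ #J)
    (hsmall : ∑ v ∈ I, G.crossDegree A v + 2 ≤ d) (hhalf : ∀ v, 2 * G.crossDegree A v ≤ d) :
    False := by
  obtain ⟨x, hx, hxmax⟩ := Finset.exists_max_image I (G.crossDegree A) hI
  obtain ⟨y, hy, hymax⟩ := Finset.exists_max_image J (G.crossDegree A) hJ
  rcases le_or_gt (G.crossDegree A y) (G.crossDegree A x) with hle | hlt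
  · exact cut_contradiction hreg hΓ hIJ hx (fun v hv => (hymax v hv).trans hle) hsmall (hhalf x)
      fun _ => hcard
  · refine cut_contradiction hreg hΓ hIJ.compl hy (fun v hv => ?_) ?_ ?_ fun h2 => ?_
    · simpa only [crossDegree_compl] using (hxmax v hv).trans hlt.le
    · simpa only [crossDegree_compl, ← hIJ.sum_crossDegree_eq] using hsmall
    · simpa only [crossDegree_compl] using hhalf y
    · -- all crossing degrees on the side of `I` are one, so `#I` is the size of the cut
      rw [crossDegree_compl] at h2
      have h1 : ∑ v ∈ I, G.crossDegree A v ≤ #I := by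
        rw [Finset.card_eq_sum_ones]
        exact Finset.sum_le_sum fun v hv => by have := hxmax v hv; omega
      have h3 : #J ≤ ∑ v ∈ J, G.crossDegree A v := by
        rw [Finset.card_eq_sum_ones]
        exact Finset.sum_le_sum fun v hv => ((hIJ.mem_outer v).1 hv).2
      rw [hIJ.sum_crossDegree_eq] at h1
      exact h3.trans h1

open scoped Classical in
/-- The number of edges between the finite vertex set `C` and its complement. -/
noncomputable def cutSize (G : SimpleGraph V) [G.LocallyFinite] (C : Finset V) : ℕ :=
  ∑ v ∈ C, #{u ∈ G.neighborFinset v | u ∉ C}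

open scoped Classical in
lemma crossDegree_of_mem {C : Finset V} {v : V} (hv : v ∈ C) :
    G.crossDegree C v = #{u ∈ G.neighborFinset v | u ∉ C} := by
  simp [crossDegree, hv]

open scoped Classical in
lemma crossDegree_of_notMem {C : Finset V} {v : V} (hv : v ∉ C) :
    G.crossDegree C v = #{u ∈ G.neighborFinset v | u ∈ C} := by
  simp [crossDegree, hv]

open scoped Classical in
/-- The effect on a cut of moving the vertex `v` to the other side. -/
lemma cutSize_insert {C : Finset V} {v : V} (hv : v ∉ C) :
    G.cutSize (insert v C) + #{u ∈ G.neighborFinset v | u ∈ C}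
      = G.cutSize C + #{u ∈ G.neighborFinset v | u ∉ C} := by
  have h1 : #{u ∈ G.neighborFinset v | u ∉ insert v C} = #{u ∈ G.neighborFinset v | u ∉ C} := by
    congr 1
    refine Finset.filter_congr fun u hu => ?_
    rw [mem_neighborFinset] at hu
    simp [hu.ne']
  have h2 : ∀ u, #{w ∈ G.neighborFinset u | w ∉ C}
      = #{w ∈ G.neighborFinset u | w ∉ insert v C} + if u ∈ G.neighborFinset v then 1 else 0 := by
    intro u
    have : ({w ∈ G.neighborFinset u | w ∉ insert v C} : Finset V)
        = ({w ∈ G.neighborFinset u | w ∉ C} : Finset V).erase v := by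
      ext w; simp only [mem_filter, mem_insert, mem_erase, not_or]; tauto
    rw [this]
    split_ifs with h
    · rw [Finset.card_erase_add_one]
      rw [mem_neighborFinset] at h
      simp [h.symm, hv]
    · rw [Finset.erase_eq_of_notMem, add_zero]
      rw [mem_neighborFinset, G.adj_comm] at h
      simp [h]
  have h3 : ∑ u ∈ C, (if u ∈ G.neighborFinset v then 1 else 0)
      = #{u ∈ G.neighborFinset v | u ∈ C} := by
    rw [Finset.sum_boole, Nat.cast_id]
    congr 1
    ext u; simp only [mem_filter]; tauto
  rw [cutSize, cutSize, Finset.sum_insert hv, h1, Finset.sum_congr rfl fun u _ => h2 u,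
    Finset.sum_add_distrib, h3]
  omega

open scoped Classical in
lemma card_filter_mem_add_card_filter_notMem {d : ℕ} (hreg : G.IsRegularOfDegree d)
    (C : Finset V) (v : V) :
    #{u ∈ G.neighborFinset v | u ∈ C} + #{u ∈ G.neighborFinset v | u ∉ C} = d := by
  rw [Finset.card_filter_add_card_filter_not, card_neighborFinset_eq_degree, hreg v]

lemma sum_crossDegree_eq_cutSize {C I J : Finset V} (hIJ : G.IsCutBoundary C I J) :
    ∑ v ∈ I, G.crossDegree C v = G.cutSize C := by
  classical
  rw [cutSize]
  have hsub : I ⊆ C := fun v hv => ((hIJ.mem_inner v).1 hv).1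
  rw [Finset.sum_subset hsub]
  · exact Finset.sum_congr rfl fun v hv => crossDegree_of_mem hv
  · intro v hv hvI
    by_contra h
    exact hvI ((hIJ.mem_inner v).2 ⟨hv, Nat.pos_of_ne_zero h⟩)

lemma exists_isCutBoundary (G : SimpleGraph V) [G.LocallyFinite] (C : Finset V) :
    ∃ I J, G.IsCutBoundary C I J := by
  classical
  refine ⟨{v ∈ C | 0 < G.crossDegree C v}, {v ∈ C.biUnion (fun u => G.neighborFinset u) | v ∉ C},
    ?_, ?_⟩
  · simp
  · intro v
    simp only [mem_filter, mem_biUnion, mem_neighborFinset, mem_coe]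
    constructor
    · rintro ⟨⟨u, hu, huv⟩, hv⟩
      exact ⟨hv, crossDegree_pos huv.symm (by simp [hu, hv])⟩
    · rintro ⟨hv, hpos⟩
      obtain ⟨u, huv, h⟩ := exists_adj_of_crossDegree_pos hpos
      refine ⟨⟨u, ?_, huv.symm⟩, hv⟩
      simp only [mem_coe] at h
      tauto

/-- A cut of a nonempty finite proper vertex set has at least `d - 1` edges. -/
theorem le_cutSize_add_one {d : ℕ} (hconn : G.Connected) (hreg : G.IsRegularOfDegree d)
    (hΓ : ∀ (f : V → ℝ) x, 0 ≤ G.bakryGammaTwo f f x) {C : Finset V} (hC : C.Nonempty)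
    (hC' : ∃ v, v ∉ C) : d ≤ G.cutSize C + 1 := by
  classical
  by_contra! hlt
  let bad : Set (Finset V) := {C | C.Nonempty ∧ (∃ v, v ∉ C) ∧ G.cutSize C + 2 ≤ d}
  obtain ⟨D, ⟨hD, hD', hDd⟩, hmin⟩ := (measure G.cutSize).wf.has_min bad ⟨C, hC, hC', by omega⟩
  have hmin' : ∀ E ∈ bad, G.cutSize D ≤ G.cutSize E := fun E hE => not_lt.1 (hmin E hE)
  obtain ⟨I, J, hIJ⟩ := G.exists_isCutBoundary D
  have hsum := sum_crossDegree_eq_cutSize hIJ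
  have hsum' := hIJ.sum_crossDegree_eq
  obtain ⟨u, w, hu, hw, huw⟩ : ∃ u w, u ∈ D ∧ w ∉ D ∧ G.Adj u w := by
    obtain ⟨a, ha⟩ := hD
    obtain ⟨b, hb⟩ := hD'
    obtain ⟨p⟩ := hconn.preconnected a b
    obtain ⟨e, -, h1, h2⟩ := p.exists_boundary_dart (D : Set V) (by simpa using ha)
      (by simpa using hb)
    exact ⟨e.fst, e.snd, by simpa using h1, by simpa using h2, e.adj⟩
  have huI : u ∈ I := (hIJ.mem_inner u).2 ⟨hu, crossDegree_pos huw (by simp [hu, hw])⟩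
  have hwJ : w ∈ J := (hIJ.mem_outer w).2 ⟨hw, crossDegree_pos huw.symm (by simp [hu, hw])⟩
  -- moving a vertex across a minimum cut does not decrease the cut
  have hhalf : ∀ v, 2 * G.crossDegree D v ≤ d := by
    intro v
    have hd := card_filter_mem_add_card_filter_notMem hreg D v
    by_contra! hgt
    have hpos : 0 < G.crossDegree D v := by omega
    by_cases hv : v ∈ D
    · have hle : G.crossDegree D v ≤ G.cutSize D := by
        rw [← hsum]
        exact Finset.single_le_sum (f := G.crossDegree D) (fun _ _ => Nat.zero_le _)
          ((hIJ.mem_inner v).2 ⟨hv, hpos⟩)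
      rw [crossDegree_of_mem hv] at hgt hle
      have hins := cutSize_insert (G := G) (Finset.notMem_erase v D)
      have h1 : #{u ∈ G.neighborFinset v | u ∈ D.erase v} = #{u ∈ G.neighborFinset v | u ∈ D} := by
        congr 1
        refine Finset.filter_congr fun u hu => ?_
        rw [mem_neighborFinset] at hu
        simp [hu.ne']
      have hd' := card_filter_mem_add_card_filter_notMem hreg (D.erase v) v
      rw [Finset.insert_erase hv] at hins
      have hne : (D.erase v).Nonempty := by
        obtain ⟨z, hz⟩ := Finset.card_pos.1 (show 0 < #{u ∈ G.neighborFinset v | u ∈ D.erase v} by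
          omega)
        exact ⟨z, (mem_filter.1 hz).2⟩
      have := hmin' (D.erase v) ⟨hne, ⟨v, by simp⟩, by omega⟩
      omega
    · have hle : G.crossDegree D v ≤ G.cutSize D := by
        rw [← hsum, hsum']
        exact Finset.single_le_sum (f := G.crossDegree D) (fun _ _ => Nat.zero_le _)
          ((hIJ.mem_outer v).2 ⟨hv, hpos⟩)
      rw [crossDegree_of_notMem hv] at hgt hle
      have hins := cutSize_insert (G := G) hv
      obtain ⟨z, hz⟩ : ({u ∈ G.neighborFinset v | u ∉ D} : Finset V).Nonempty :=
        Finset.card_pos.1 (by omega)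
      rw [mem_filter, mem_neighborFinset] at hz
      have := hmin' (insert v D) ⟨⟨v, by simp⟩, ⟨z, by simp [hz.1.ne', hz.2]⟩, by omega⟩
      omega
  rcases le_total #I #J with hle | hle
  · exact cut_contradiction_of_card_le hreg hΓ hIJ ⟨u, huI⟩ ⟨w, hwJ⟩ hle (by omega) hhalf
  · refine cut_contradiction_of_card_le hreg hΓ hIJ.compl ⟨w, hwJ⟩ ⟨u, huI⟩ hle ?_ ?_
    · simp only [crossDegree_compl]; omega
    · simpa only [crossDegree_compl] using hhalf

open scoped Classical in
lemma even_sum_card_filter_mem (G : SimpleGraph V) [G.LocallyFinite] (C : Finset V) :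
    Even (∑ v ∈ C, #{u ∈ G.neighborFinset v | u ∈ C}) := by
  have key := (G.induce (C : Set V)).sum_degrees_eq_twice_card_edges
  refine ⟨#(G.induce (C : Set V)).edgeFinset, ?_⟩
  rw [← two_mul, ← key, ← Finset.sum_coe_sort C]
  refine Finset.sum_congr rfl fun v _ => ?_
  rw [← card_neighborFinset_eq_degree, ← Finset.card_map (Function.Embedding.subtype _)]
  congr 1
  ext u
  simp

/-- For vertex sets of odd cardinality the lower bound on cuts improves to `d`, as `d * #C` and the
size of the cut have the same parity. -/
theorem le_cutSize_of_odd {d : ℕ} (hconn : G.Connected) (hreg : G.IsRegularOfDegree d)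
    (hΓ : ∀ (f : V → ℝ) x, 0 ≤ G.bakryGammaTwo f f x) {C : Finset V} (hodd : Odd #C)
    (hC' : ∃ v, v ∉ C) : d ≤ G.cutSize C := by
  classical
  have h1 := le_cutSize_add_one hconn hreg hΓ (Finset.card_pos.1 hodd.pos) hC'
  have h2 : ∑ v ∈ C, #{u ∈ G.neighborFinset v | u ∈ C} + G.cutSize C = #C * d := by
    rw [cutSize, ← Finset.sum_add_distrib,
      Finset.sum_congr rfl fun v _ => card_filter_mem_add_card_filter_notMem hreg C v]
    simp
  by_contra! hlt
  obtain ⟨a, ha⟩ := G.even_sum_card_filter_mem C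
  obtain ⟨b, hb⟩ := hodd
  have hd : d = G.cutSize C + 1 := by omega
  have : (2 * b + 1) * d = 2 * (b * d) + d := by ring
  rw [hb, this] at h2
  omega

/-! ### Matchings from edge cuts -/

open scoped Classical in
/-- Disjoint sets, each sending at least `d` edges to its complement and all of them into `U`, are
at most as many as the vertices of `U`, because only `#U * d` edges end in `U`. -/
lemma card_mul_le_card_mul_of_cutSize {d : ℕ} (hreg : G.IsRegularOfDegree d) {ι : Type*}
    (s : Finset ι) (C : ι → Finset V) (hdisj : (s : Set ι).PairwiseDisjoint C) (U : Finset V)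
    (hcut : ∀ i ∈ s, d ≤ G.cutSize (C i))
    (hU : ∀ i ∈ s, ∀ v ∈ C i, ∀ u, G.Adj v u → u ∉ C i → u ∈ U) : #s * d ≤ #U * d := by
  calc #s * d ≤ ∑ i ∈ s, G.cutSize (C i) := by
        rw [← smul_eq_mul]; exact Finset.card_nsmul_le_sum _ _ _ hcut
    _ ≤ ∑ i ∈ s, ∑ v ∈ C i, #{u ∈ U | G.Adj v u} := by
        refine Finset.sum_le_sum fun i hi => Finset.sum_le_sum fun v hv =>
          Finset.card_le_card fun u hu => ?_
        rw [mem_filter, mem_neighborFinset] at hu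
        exact mem_filter.2 ⟨hU i hi v hv u hu.1 hu.2, hu.1⟩
    _ = ∑ v ∈ s.biUnion C, #{u ∈ U | G.Adj v u} := (Finset.sum_biUnion hdisj).symm
    _ = ∑ u ∈ U, #{v ∈ s.biUnion C | G.Adj v u} :=
        Finset.sum_card_bipartiteAbove_eq_sum_card_bipartiteBelow G.Adj
    _ ≤ ∑ u ∈ U, d := by
        refine Finset.sum_le_sum fun u _ => ?_
        rw [← hreg u, ← card_neighborFinset_eq_degree]
        refine Finset.card_le_card fun v hv => ?_
        rw [mem_neighborFinset]
        exact (mem_filter.1 hv).2.symm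
    _ = #U * d := by simp

/-- The graph on `B` obtained from the induced subgraph of `G` by joining any two vertices
outside `A`. -/
def completionOutside (G : SimpleGraph V) (A B : Finset V) : SimpleGraph B where
  Adj u v := u ≠ v ∧ (G.Adj u v ∨ ((u : V) ∉ A ∧ (v : V) ∉ A))
  symm := ⟨fun _ _ h => ⟨h.1.symm, h.2.imp (fun h => h.symm) And.symm⟩⟩
  loopless := ⟨fun _ h => h.1 rfl⟩

/-- Tutte's theorem applies to the completed graph: its vertices outside `A` survive in a single
component, so that all other odd components lie inside `A` and send `d` or more edges of `G` into
the removed set. As `#B` is even, a Tutte violator would leave at least two components too many. -/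
lemma exists_isPerfectMatching_completionOutside {d : ℕ} (hd : 1 ≤ d)
    (hreg : G.IsRegularOfDegree d) (hcut : ∀ C : Finset V, Odd #C → d ≤ G.cutSize C)
    {A B : Finset V} (hB : Even #B) (hAB : ∀ v ∈ A, ∀ u, G.Adj v u → u ∈ B) :
    ∃ M : (G.completionOutside A B).Subgraph, M.IsPerfectMatching := by
  classical
  rw [tutte]
  intro U hviol
  unfold IsTutteViolator at hviol
  set T := ((⊤ : (G.completionOutside A B).Subgraph).deleteVerts U).verts with hT
  set K : SimpleGraph T := ((⊤ : (G.completionOutside A B).Subgraph).deleteVerts U).coe with hK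
  have hTU' : ∀ b : B, b ∈ T ↔ b ∉ U := fun b => by simp [hT]
  have hTU : T = Uᶜ := Set.ext hTU'
  have hKadj : ∀ a b : T, K.Adj a b ↔ (G.completionOutside A B).Adj a b := by
    intro a b
    have ha : (a : B) ∉ U := (hTU' _).1 a.2
    have hb : (b : B) ∉ U := (hTU' _).1 b.2
    simp [hK, ha, hb]
  have hparity : U.ncard + 2 ≤ K.oddComponents.ncard := by
    have h1 : Odd K.oddComponents.ncard ↔ Odd (Nat.card T) := K.odd_ncard_oddComponents
    have h2 : U.ncard + Nat.card T = #B := by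
      rw [Nat.card_coe_set_eq, hTU, Set.ncard_add_ncard_compl]; simp
    rw [← h2, Nat.even_add, ← Nat.not_odd_iff_even, ← Nat.not_odd_iff_even, ← h1] at hB
    rcases Nat.lt_or_ge (U.ncard + 1) K.oddComponents.ncard with h | h
    · exact h
    · have h3 : K.oddComponents.ncard = U.ncard + 1 := by omega
      rw [h3, Nat.odd_add_one] at hB
      tauto
  -- a component not contained in `A` contains all vertices of `B \ A` that are not removed
  have hgood : U.ncard + 1 ≤ {c ∈ K.oddComponents | ∀ v ∈ c.supp, ((v : B) : V) ∈ A}.ncard := by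
    have hsub : K.oddComponents ⊆ {c ∈ K.oddComponents | ∀ v ∈ c.supp, ((v : B) : V) ∈ A} ∪
        {c | ∃ v ∈ c.supp, ((v : B) : V) ∉ A} := by
      intro c hc
      by_cases h : ∀ v ∈ c.supp, ((v : B) : V) ∈ A
      · exact Or.inl ⟨hc, h⟩
      · push Not at h
        exact Or.inr h
    have hone : {c : K.ConnectedComponent | ∃ v ∈ c.supp, ((v : B) : V) ∉ A}.ncard ≤ 1 := by
      rw [Set.ncard_le_one_iff]
      rintro _ _ ⟨v, rfl, hv⟩ ⟨w, rfl, hw⟩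
      by_cases hvw : v = w
      · rw [hvw]
      · refine ConnectedComponent.sound (Adj.reachable ((hKadj v w).2 ⟨?_, Or.inr ⟨hv, hw⟩⟩))
        exact fun h => hvw (Subtype.ext h)
    have := Set.ncard_le_ncard hsub (Set.toFinite _)
    have := Set.ncard_union_le {c ∈ K.oddComponents | ∀ v ∈ c.supp, ((v : B) : V) ∈ A}
      {c : K.ConnectedComponent | ∃ v ∈ c.supp, ((v : B) : V) ∉ A}
    omega
  have hφ : Function.Injective (fun v : T => ((v : B) : V)) :=
    Subtype.val_injective.comp Subtype.val_injective
  set s : Finset K.ConnectedComponent :=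
    (Set.toFinite {c ∈ K.oddComponents | ∀ v ∈ c.supp, ((v : B) : V) ∈ A}).toFinset with hs
  have hmem : ∀ c, c ∈ s ↔ Odd c.supp.ncard ∧ ∀ v ∈ c.supp, ((v : B) : V) ∈ A := by
    intro c; simp [hs]
  set C : K.ConnectedComponent → Finset V := fun c =>
    (Set.toFinite c.supp).toFinset.image (fun v : T => ((v : B) : V)) with hC
  have hCmem : ∀ c v, v ∈ C c ↔ ∃ t : T, t ∈ c.supp ∧ ((t : B) : V) = v := by
    intro c v; simp [hC]
  have key := card_mul_le_card_mul_of_cutSize hreg s C ?_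
    ((Set.toFinite U).toFinset.image (fun v : B => (v : V))) ?_ ?_
  · rw [Finset.card_image_of_injective _ Subtype.val_injective, ← Set.ncard_eq_toFinset_card,
      ← Set.ncard_eq_toFinset_card] at key
    have := Nat.le_of_mul_le_mul_right key hd
    omega
  · intro c _ c' _ hne
    rw [Function.onFun, Finset.disjoint_left]
    intro v hv hv'
    obtain ⟨t, ht, rfl⟩ := (hCmem c v).1 hv
    obtain ⟨t', ht', h⟩ := (hCmem c' _).1 hv'
    obtain rfl := hφ h
    exact hne (ht.symm.trans ht')
  · intro c hc
    refine hcut _ ?_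
    rw [hC, Finset.card_image_of_injective _ hφ, ← Set.ncard_eq_toFinset_card]
    exact ((hmem c).1 hc).1
  · intro c hc v hv u huv hu
    obtain ⟨t, ht, rfl⟩ := (hCmem c v).1 hv
    have huB : u ∈ B := hAB _ (((hmem c).1 hc).2 t ht) u huv
    by_contra hU
    have huU : (⟨u, huB⟩ : B) ∉ U := fun h => hU (by simp [huB, h])
    have huT : (⟨u, huB⟩ : B) ∈ T := by rw [hTU]; exact huU
    refine hu ((hCmem c u).2 ⟨⟨⟨u, huB⟩, huT⟩, ?_, rfl⟩)
    have hadj : K.Adj t ⟨⟨u, huB⟩, huT⟩ :=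
      (hKadj _ _).2 ⟨fun h => huv.ne (congrArg Subtype.val h), Or.inl huv⟩
    exact (ConnectedComponent.mem_supp_congr_adj c hadj).1 ht

/-- Every finite `A` can be covered by a matching: all edges at `A` of a perfect matching of the
completed graph are edges of `G`. -/
lemma exists_partner_on_finset {d : ℕ} (hd : 1 ≤ d)
    (hreg : G.IsRegularOfDegree d) (hcut : ∀ C : Finset V, Odd #C → d ≤ G.cutSize C)
    {A B : Finset V} (hB : Even #B) (hA : A ⊆ B) (hAB : ∀ v ∈ A, ∀ u, G.Adj v u → u ∈ B) :
    ∃ m : V → V, ∀ v ∈ A, G.Adj v (m v) ∧ m (m v) = v := by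
  classical
  obtain ⟨M, hM⟩ := exists_isPerfectMatching_completionOutside hd hreg hcut hB hAB
  rw [Subgraph.isPerfectMatching_iff] at hM
  choose n hn hn' using hM
  refine ⟨fun v => if h : v ∈ B then n ⟨v, h⟩ else v, fun v hv => ?_⟩
  have hvB := hA hv
  have hadj := hn ⟨v, hvB⟩
  refine ⟨?_, ?_⟩
  · have := M.adj_sub hadj
    simp only [hvB, dif_pos]
    exact this.2.resolve_right fun h => h.1 hv
  · simp only [hvB, dif_pos, Subtype.coe_eta, Finset.coe_mem]
    exact congrArg Subtype.val (hn' _ _ hadj.symm).symm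

/-- Compactness: matchings covering arbitrary finite sets of a locally finite graph give a perfect
matching, by Rado's selection lemma applied to the choices of partners. -/
lemma exists_isPerfectMatching_of_partner
    (h : ∀ A : Finset V, ∃ m : V → V, ∀ v ∈ A, G.Adj v (m v) ∧ m (m v) = v) :
    ∃ M : G.Subgraph, M.IsPerfectMatching := by
  classical
  -- covering also the neighbours of `A` makes the partner of a vertex of `A` point back to it
  choose m hm using fun A : Finset V => h (A ∪ A.biUnion fun v => G.neighborFinset v)
  obtain ⟨χ, hχ⟩ := Finset.rado_selection
    (β := fun v => {u // u ∈ insert v (G.neighborFinset v)})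
    fun A v => if hv : G.Adj v (m A v) then ⟨m A v, by simp [hv]⟩ else ⟨v, by simp⟩
  have key : ∀ v, G.Adj v (χ v) ∧ (χ (χ v) : V) = v := by
    intro v
    obtain ⟨t, ht, hagree⟩ := hχ {v, (χ v : V)}
    have hvt : v ∈ t := ht (by simp)
    obtain ⟨hadj, hinv⟩ := hm t v (by simp [hvt])
    have h1 : (χ v : V) = m t v := by rw [hagree v (by simp), dif_pos hadj]
    have h2 : (χ (χ v) : V) = v := by
      rw [hagree (χ v) (by simp), h1, dif_pos (by rw [hinv]; exact hadj.symm)]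
      exact hinv
    exact ⟨h1 ▸ hadj, h2⟩
  refine ⟨{ verts := Set.univ, Adj := fun v w => (χ v : V) = w, adj_sub := ?_, edge_vert := ?_,
            symm := ?_ }, ?_⟩
  · rintro v w rfl
    exact (key v).1
  · intros; trivial
  · refine ⟨?_⟩
    rintro v w rfl
    exact (key v).2
  · rw [Subgraph.isPerfectMatching_iff]
    exact fun v => ⟨χ v, rfl, fun w hw => Eq.symm hw⟩

end SimpleGraph

theorem theorem1p1 {V : Type*} (G : SimpleGraph V) [G.LocallyFinite] (d : ℕ)
    (hconn : G.Connected) (hreg : G.IsRegularOfDegree d)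
    (hcard : (Finite V ∧ Even (Nat.card V)) ∨ Infinite V)
    (hcurv : 0 ≤ G.bakryEmeryCurvature) :
    ∃ M : G.Subgraph, M.IsPerfectMatching := by
  classical
  have hproper : ∀ C : Finset V, Odd C.card → ∃ v, v ∉ C := by
    intro C hC
    by_contra! hall
    rcases hcard with ⟨hfin, heven⟩ | hinf
    · have := Fintype.ofFinite V
      rw [Finset.eq_univ_of_forall hall, Finset.card_univ, ← Nat.card_eq_fintype_card] at hC
      exact Nat.not_odd_iff_even.2 heven hC
    · obtain ⟨v, hv⟩ := Infinite.exists_notMem_finset C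
      exact hv (hall v)
  have hcut : ∀ C : Finset V, Odd C.card → d ≤ G.cutSize C := fun C hC =>
    SimpleGraph.le_cutSize_of_odd hconn hreg (SimpleGraph.bakryGammaTwo_nonneg hcurv) hC
      (hproper C hC)
  have hd : 1 ≤ d := by
    obtain ⟨v⟩ := hconn.nonempty
    obtain ⟨w, hw⟩ := hproper {v} (by simp)
    have : Nontrivial V := ⟨w, v, by simpa using hw⟩
    rw [← hreg v]
    exact hconn.preconnected.degree_pos_of_nontrivial v
  refine SimpleGraph.exists_isPerfectMatching_of_partner fun A => ?_
  obtain ⟨B, hB, hAB⟩ : ∃ B : Finset V, Even B.card ∧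
      A ∪ A.biUnion (fun v => G.neighborFinset v) ⊆ B := by
    by_cases heven : Even (A ∪ A.biUnion fun v => G.neighborFinset v).card
    · exact ⟨_, heven, subset_rfl⟩
    · obtain ⟨v, hv⟩ := hproper _ (Nat.not_even_iff_odd.1 heven)
      refine ⟨insert v _, ?_, Finset.subset_insert _ _⟩
      rw [Finset.card_insert_of_notMem hv]
      exact (Nat.not_even_iff_odd.1 heven).add_one
  refine SimpleGraph.exists_partner_on_finset hd hreg hcut hB
    (Finset.subset_union_left.trans hAB) fun v hv u huv => hAB ?_
  exact Finset.mem_union_right _ (Finset.mem_biUnion.2 ⟨v, hv, by simpa using huv⟩)
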